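/- Let $q(x_1,\dots,x_k)=S_1(\dots),\dots,S_\ell(\dots)$ be a full conjunctive query without self-joins, $\ell\ge 1$, where $S_j$ has arity $a_j\ge 1$. Fix positive integers $m_1,\dots,m_\ell$ (the numbers of tuples of the relations), a domain $[n]$ with $n\ge(\max_j m_j)^2$, and let $\mathbf M=(M_1,\dots,M_\ell)$ with $M_j=a_jm_j\log_2 n$ be the relation sizes in bits. Let $p\ge 1$ be the number of servers. Model: in a deterministic one-round MPC algorithm, server $s\in[p]$ receives for every $j$ a bit string $\mathrm{msg}_{j,s}(S_j)$, an arbitrary function of the relation $S_j$ alone (each relation is initially held separately), and then outputs a set of tuples that is an arbitrary function of the messages it received; the algorithm computes $q$ on an instance $I$ if the union of the outputs of the servers is $q(I)$. Its load on $I$ is the maximum over the servers of the total number of bits received. For $\mathbf x\subseteq\mathrm{vars}(q)$ let $q_{\mathbf x}$ be the residual query, obtained from $q$ by deleting the variables $\mathbf x$ from all atoms and dropping the atoms that have no variable left. Let $$L^{(q_{\mathbf x})}(\mathbf M,p)=\max_{\mathbf u}\left(\frac{\prod_{j}M_j^{u_j}}{p}\right)^{1/\sum_j u_j},$$ where $j$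 ranges over the atoms of $q_{\mathbf x}$ and $\mathbf u$ over the nonzero fractional edge packings of $q_{\mathbf x}$ (weights $u_j\ge0$ such that for each variable of $q_{\mathbf x}$ the weights of the atoms containing it sum to at most $1$); it is $0$ if $q_{\mathbf x}$ has no atoms. For $\alpha\in[n]$ let $\mathcal D_{\mathbf x}$ be the following random instance, with independent relations. If $S_j$ has a variable outside $\mathbf x$, then $S_j$ is uniformly random among the relations with $m_j$ tuples in which all attributes with variables in $\mathbf x$ equal $\alpha$, positions with the same variable carry the same value, and every value occurs at most once in each attribute whose variable is not in $\mathbf x$ (a matching). If all variables of $S_j$ are in $\mathbf x$, then $S_j$ is uniformly random among the relations with $m_j$ tuples that consist of $(\alpha,\dots,\alpha)$ and of tuples of values different from $\alpha$. Then, for every $\alpha\in[n]$: 1. For every $\mathbf x\subseteq\mathrm{vars}(q)$, every deterministic one-round MPC algorithm on $p$ servers that computes $q$ on all instances in the support of $\mathcal D_{\mathbf x}$, with maximum load $L$ (in bits) over these instances, satisfies $$L\ \ge\ \min_{1\le j\le \ell}\frac1{4a_j}\cdot L^{(q_{\mathbf x})}(\mathbf M,p).$$ 2. Consequently there is an $\mathbf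 x\subseteq\mathrm{vars}(q)$ such that every deterministic one-round MPC algorithm on $p$ servers that computes $q$ on all instances in the support of $\mathcal D_{\mathbf x}$, with maximum load $L$ over these instances, satisfies $$L\ \ge\ \min_{1\le j\le \ell}\frac1{4a_j}\cdot\max_{\mathbf y\subseteq\mathrm{vars}(q)}L^{(q_{\mathbf y})}(\mathbf M,p).$$ -/

import Mathlib

/-- A full conjunctive query without self-joins. `V` is the set of variables and `ι` indexes the
atoms (one relation symbol per index, hence no self-joins); `atom j` is the list of the variables
at the positions of the `j`-th atom. Every atom has positive arity, and every variable occurs in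
some atom. -/
structure ConjunctiveQuery (V ι : Type*) where
  atom : ι → List V
  atom_ne_nil : ∀ j, atom j ≠ []
  exists_mem_atom : ∀ v, ∃ j, v ∈ atom j

namespace ConjunctiveQuery

variable {V ι : Type*}

/-- The arity of the `j`-th relation. -/
def arity (q : ConjunctiveQuery V ι) (j : ι) : ℕ := (q.atom j).length

/-- The variable at position `i` of the `j`-th atom. -/
def var (q : ConjunctiveQuery V ι) (j : ι) (i : Fin (q.arity j)) : V := (q.atom j).get i

/-- A tuple of the `j`-th relation over the domain `[n]`. -/
abbrev Tuple (q : ConjunctiveQuery V ι) (n : ℕ) (j : ι) : Type := Fin (q.arity j) → Fin n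

/-- A database instance over the domain `[n]`: one finite relation for each symbol. -/
abbrev Instance (q : ConjunctiveQuery V ι) (n : ℕ) : Type _ := (j : ι) → Finset (q.Tuple n j)

/-- The answers of `q` on the instance `I`. -/
def answers (q : ConjunctiveQuery V ι) {n : ℕ} (I : q.Instance n) : Set (V → Fin n) :=
  {a | ∀ j, (fun i => a (q.var j i)) ∈ I j}

/-! ### Residual queries, packings and the load formula -/

section Load

variable [DecidableEq V]

/-- The residual query: the variables of `x` are removed from every atom, and the atoms whose
variables all belong to `x` are dropped. -/
def residual (q : ConjunctiveQuery V ι) (x : Finset V) :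
    ConjunctiveQuery {v : V // v ∉ x} {j : ι // ∃ v ∈ q.atom j, v ∉ x} where
  atom j := (q.atom j.1).filterMap fun v => if h : v ∉ x then some ⟨v, h⟩ else none
  atom_ne_nil := by
    rintro ⟨j, v, hv, hx⟩ h
    rw [List.filterMap_eq_nil_iff] at h
    simpa [hx] using h v hv
  exists_mem_atom := by
    rintro ⟨v, hx⟩
    obtain ⟨j, hj⟩ := q.exists_mem_atom v
    exact ⟨⟨j, v, hj, hx⟩, List.mem_filterMap.2 ⟨v, hj, by simp [hx]⟩⟩

/-- The fractional edge packings of `q`. -/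
def packings [Fintype ι] (q : ConjunctiveQuery V ι) : Set (ι → ℝ) :=
  {u | (∀ j, 0 ≤ u j) ∧ ∀ v, ∑ j with v ∈ q.atom j, u j ≤ 1}

/-- `L(u, M, p) = (∏ⱼ Mⱼ ^ uⱼ / p) ^ (1 / ∑ⱼ uⱼ)`. -/
noncomputable def packingLoad [Fintype ι] (u M : ι → ℝ) (p : ℕ) : ℝ :=
  ((∏ j, M j ^ u j) / p) ^ (1 / ∑ j, u j)

/-- `L^{(q)}(M, p)`, the maximum of `L(u, M, p)` over the nonzero fractional edge packings of `q`
(the exponent `1 / ∑ⱼ uⱼ` is undefined for `u = 0`). It is `0` for the query without atoms. -/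
noncomputable def maxPackingLoad [Fintype ι] (q : ConjunctiveQuery V ι) (M : ι → ℝ) (p : ℕ) : ℝ :=
  sSup ((fun u => packingLoad u M p) '' {u | u ∈ q.packings ∧ u ≠ 0})

/-- The supremum in `maxPackingLoad` is that of a bounded set. -/
theorem bddAbove_packingLoad [Fintype ι] (q : ConjunctiveQuery V ι) (M : ι → ℝ)
    (hM : ∀ j, 0 ≤ M j) (p : ℕ) (hp : 0 < p) :
    BddAbove ((fun u => packingLoad u M p) '' {u | u ∈ q.packings ∧ u ≠ 0}) := by
  refine ⟨∑ j, M j, ?_⟩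
  rintro _ ⟨u, ⟨hu, hu0⟩, rfl⟩
  have hB : 0 ≤ ∑ j, M j := Finset.sum_nonneg fun j _ => hM j
  have hs : 0 < ∑ j, u j := by
    obtain ⟨j, hj⟩ := Function.ne_iff.1 hu0
    exact Finset.sum_pos' (fun j _ => hu.1 j)
      ⟨j, Finset.mem_univ j, lt_of_le_of_ne (hu.1 j) (Ne.symm hj)⟩
  have hprod0 : 0 ≤ ∏ j, M j ^ u j :=
    Finset.prod_nonneg fun j _ => Real.rpow_nonneg (hM j) _
  have hprod : ∏ j, M j ^ u j ≤ (∑ j, M j) ^ ∑ j, u j := by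
    rw [Real.rpow_sum_of_nonneg hB (fun j _ => hu.1 j)]
    refine Finset.prod_le_prod (fun j _ => Real.rpow_nonneg (hM j) _) fun j _ => ?_
    exact Real.rpow_le_rpow (hM j)
      (Finset.single_le_sum (fun i _ => hM i) (Finset.mem_univ j)) (hu.1 j)
  have hp1 : (1 : ℝ) ≤ p := by exact_mod_cast hp
  calc packingLoad u M p ≤ ((∑ j, M j) ^ ∑ j, u j) ^ (1 / ∑ j, u j) :=
        Real.rpow_le_rpow (by positivity) ((div_le_self hprod0 hp1).trans hprod) (by positivity)
    _ = ∑ j, M j := by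
        rw [← Real.rpow_mul hB, mul_one_div_cancel hs.ne', Real.rpow_one]

end Load

/-- The size in bits `Mⱼ = aⱼ mⱼ log₂ n` of a `j`-th relation with `mⱼ` tuples over `[n]`. -/
noncomputable def bitSize (q : ConjunctiveQuery V ι) (m : ι → ℕ) (n : ℕ) (j : ι) : ℝ :=
  q.arity j * m j * Real.logb 2 n

/-- `L^{(q_x)}(M, p)` for the residual query `q_x` and the sizes `M` of the relations of `q`. -/
noncomputable def residualLoad [DecidableEq V] [Fintype ι] (q : ConjunctiveQuery V ι)
    (x : Finset V) (M : ι → ℝ) (p : ℕ) : ℝ :=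
  (q.residual x).maxPackingLoad (fun j => M j.1) p

/-- `min_j 1 / (4 aⱼ)`. -/
noncomputable def minInvArity [Fintype ι] [Nonempty ι] (q : ConjunctiveQuery V ι) : ℝ :=
  Finset.univ.inf' Finset.univ_nonempty fun j => 1 / (4 * (q.arity j : ℝ))

/-! ### One-round algorithms -/

/-- A deterministic one-round MPC algorithm on `p` servers, for inputs over the domain `[n]`.
In the communication phase server `s` receives, for every `j`, a bit string `msg j (I j) s`, the
part of its data that originates from the `j`-th relation (the holder of a relation knows only
this relation, and the message may be any function of it). In the computation phase server `s`
outputs a set of tuples which may be any function of the messages it received. -/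
structure OneRoundAlgorithm (q : ConjunctiveQuery V ι) (n p : ℕ) where
  msg : (j : ι) → Finset (q.Tuple n j) → Fin p → List Bool
  output : Fin p → (ι → List Bool) → Set (V → Fin n)

namespace OneRoundAlgorithm

variable {q : ConjunctiveQuery V ι} {n p : ℕ}

/-- The algorithm is correct on `I`: the union of the outputs of the servers is `q(I)`. -/
def ComputesOn (A : q.OneRoundAlgorithm n p) (I : q.Instance n) : Prop :=
  ⋃ s, A.output s (fun j => A.msg j (I j) s) = q.answers I

/-- The maximum, over all servers, of the number of bits that the server receives on input `I`. -/
def load [Fintype ι] (A : q.OneRoundAlgorithm n p) (I : q.Instance n) : ℕ :=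
  Finset.univ.sup fun s => ∑ j, (A.msg j (I j) s).length

end OneRoundAlgorithm

/-- The random instances `D` force load `b` for `q` on `p` servers: every deterministic one-round
algorithm on `p` servers that computes `q` on all instances in the support of `D`, with maximum
load `L` on these instances, has `L ≥ b`. -/
def ForcesLoad [Fintype ι] (q : ConjunctiveQuery V ι) {n : ℕ} (D : PMF (q.Instance n)) (p : ℕ)
    (b : ℝ) : Prop :=
  ∀ A : q.OneRoundAlgorithm n p, (∀ I ∈ D.support, A.ComputesOn I) →
    ∀ L : ℕ, (∀ I ∈ D.support, A.load I ≤ L) → b ≤ L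

/-! ### The random instances -/

section Skew

variable [DecidableEq V]

/-- The possible `j`-th relations of the skewed instances, all with `m` tuples.

If the atom has a variable outside `x`: the attributes with variables in `x` are constantly `α`,
and the other ones form a matching, that is, every value occurs in such an attribute at most once
(positions with the same variable carry the same value).

If all variables of the atom are in `x`: the relation consists of the tuple `(α, …, α)` and of
arbitrary tuples of values other than `α`. -/
noncomputable def skewRelations (q : ConjunctiveQuery V ι) {n : ℕ} (x : Finset V) (α : Fin n)
    (m : ℕ) (j : ι) : Finset (Finset (q.Tuple n j)) :=
  open Classical in
  Finset.univ.filter fun S => S.card = m ∧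
    if ∃ v ∈ q.atom j, v ∉ x then
      (∀ t ∈ S, ∀ i, q.var j i ∈ x → t i = α) ∧
      (∀ t ∈ S, ∀ i i', q.var j i = q.var j i' → t i = t i') ∧
      (∀ t ∈ S, ∀ t' ∈ S, ∀ i, q.var j i ∉ x → t i = t' i → t = t')
    else
      (fun _ => α) ∈ S ∧ ∀ t ∈ S, t ≠ (fun _ => α) → ∀ i, t i ≠ α

theorem skewRelations_nonempty (q : ConjunctiveQuery V ι) {n : ℕ} (x : Finset V) (α : Fin n)
    {m : ℕ} (hm : 0 < m) (hn : m ≤ n) (j : ι) : (q.skewRelations x α m j).Nonempty := by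
  classical
  obtain ⟨T, hT, hTm⟩ := Finset.exists_superset_card_eq (s := ({α} : Finset (Fin n))) (n := m)
    (by rw [Finset.card_singleton]; exact hm) (by rw [Fintype.card_fin]; exact hn)
  have hα : α ∈ T := hT (Finset.mem_singleton_self α)
  by_cases h : ∃ v ∈ q.atom j, v ∉ x
  · let f : Fin n → q.Tuple n j := fun c i => if q.var j i ∈ x then α else c
    have hf : Function.Injective f := by
      obtain ⟨v, hv, hx⟩ := h
      obtain ⟨i, hi⟩ := List.get_of_mem hv
      intro c d hcd
      have h1 : q.var j i ∉ x := by
        have h2 : q.var j i = v := hi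
        rw [h2]; exact hx
      simpa [f, h1] using congrFun hcd i
    refine ⟨T.image f, ?_⟩
    simp only [skewRelations, Finset.mem_filter, Finset.mem_univ, true_and, if_pos h,
      Finset.card_image_of_injective _ hf, hTm, Finset.forall_mem_image]
    refine ⟨fun c _ i hi => by simp [f, hi], fun c _ i i' hi => by simp [f, hi],
      fun c _ d _ i hi hcd => ?_⟩
    have : c = d := by simpa [f, hi] using hcd
    rw [this]
  · let f : Fin n → q.Tuple n j := fun c _ => c
    have hf : Function.Injective f := fun c d hcd =>
      congrFun hcd ⟨0, List.length_pos_of_ne_nil (q.atom_ne_nil j)⟩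
    refine ⟨T.image f, ?_⟩
    simp only [skewRelations, Finset.mem_filter, Finset.mem_univ, true_and, if_neg h,
      Finset.card_image_of_injective _ hf, hTm, Finset.forall_mem_image]
    refine ⟨Finset.mem_image_of_mem f hα, fun c _ hc i hi => hc ?_⟩
    have : c = α := hi
    rw [this]

/-- The family of instances with `m j` tuples in the `j`-th relation that are matchings on the
variables outside `x` and constantly `α` on the variables in `x`. -/
noncomputable def skewFamily [Fintype ι] [DecidableEq ι] (q : ConjunctiveQuery V ι) {n : ℕ}
    (m : ι → ℕ) (x : Finset V) (α : Fin n) : Finset (q.Instance n) :=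
  Fintype.piFinset fun j => q.skewRelations x α (m j) j

/-- The random skewed instance: the relations are chosen independently and uniformly, which amounts
to the uniform distribution on the product family. -/
noncomputable def skewDistribution [Fintype ι] [DecidableEq ι] (q : ConjunctiveQuery V ι) {n : ℕ}
    (m : ι → ℕ) (x : Finset V) (α : Fin n) (hm : ∀ j, 0 < m j) (hn : ∀ j, m j ≤ n) :
    PMF (q.Instance n) :=
  PMF.uniformOfFinset (q.skewFamily m x α)
    (Fintype.piFinset_nonempty.2 fun j => q.skewRelations_nonempty x α (hm j) (hn j) j)

end Skew

end ConjunctiveQuery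

/-!
The servers have to know every answer between them, and a server that receives few bits knows few
answers.

*What a message reveals.* Consider the random relation of an atom with a variable outside `x`. Since
`m ^ 2 ≤ n`, a random matching contains `k` prescribed tuples with probability at most `n ^ (-k / 2)`
(`pow_mul_card_filter_subset_sq_le`). Hence a message after which `k` tuples are certain has
probability at most `n ^ (-k / 2)`, and the expectation of `k` is at most `2 / log₂ n` times the
entropy of the message. There are at most `4 ^ L` messages of at most `L` bits, so a server knows on
average at most `4 L / log₂ n` tuples (`expect_card_knownPart_mul_logb_le`), that is, a fraction
`f j ≤ 4 L / (m j * log₂ n)` of the relation.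

*What it takes to know the answers.* Only the answers with the value `α` on `x` are counted. They are
indexed by all assignments `b`, whose values on `x` are overwritten by `α`; averages over `b` then
replace sums over the domain of each atom, and no powers of `n` have to be tracked. The messages
concern one relation each, so a server that outputs an answer knows each of its tuples. As the
relations are independent, the probability that this happens for `b` is a product over the atoms.
Normalise each factor by the probability that the tuple of `b` is in the relation, which by symmetry
is the same for all `b` (`tupleProb_eq`). The normalised factor is at most `1` and has average `f j`
(`expect_pinnedTuple_mem_mul`). For a fractional edge packing `u` of the residual query, Finner's
inequality (`expect_prod_rpow_le_of_dependsOn`) bounds the average of the product by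
`∏ j, f j ^ u j`. Summed over the servers these bounds must reach `1` (`one_le_sum_prod_rpow`), and
`1 ≤ p * ∏ j, (4 L / (m j * log₂ n)) ^ u j` is the claimed lower bound on `L`. The proof multiplies
this out, so that `n = 1`, where `log₂ n = 0`, needs no separate treatment.

The second statement is the first one for a set of variables with the largest load.
-/

/-! ### Finner's inequality for finite product spaces -/

section Finner

open Finset Function
open scoped BigOperators

/-- Hölder's inequality for averages with several factors. As the constant `1` has average `1`, the
exponents need only have a sum of at most `1`. -/
theorem expect_prod_rpow_le_prod_expect_rpow {κ Ω : Type*} [Fintype Ω] [Nonempty Ω]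
    (s : Finset κ) {u : κ → ℝ} (hu : ∀ j, 0 ≤ u j) (hsum : ∑ j ∈ s, u j ≤ 1)
    {h : κ → Ω → ℝ} (hh : ∀ j c, 0 ≤ h j c) :
    𝔼 c, ∏ j ∈ s, h j c ^ u j ≤ ∏ j ∈ s, (𝔼 c, h j c) ^ u j := by
  set H : κ → ℝ := fun j => 𝔼 c, h j c with hH
  have hH0 : ∀ j, 0 ≤ H j := fun j => expect_nonneg fun c _ => hh j c
  -- After division by the averages, the weighted AM-GM inequality is linear in each factor.
  have hnorm : ∀ j c, h j c ^ u j = H j ^ u j * (h j c / H j) ^ u j := by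
    intro j c
    rw [← Real.mul_rpow (hH0 j) (div_nonneg (hh j c) (hH0 j))]
    rcases eq_or_ne (H j) 0 with h0 | h0
    · have := (expect_eq_zero_iff_of_nonneg fun c _ => hh j c).1 h0 c (mem_univ c)
      rw [this, h0, zero_mul]
    · rw [mul_div_cancel₀ _ h0]
  have hamgm : ∀ c, ∏ j ∈ s, (h j c / H j) ^ u j
      ≤ ∑ j ∈ s, u j * (h j c / H j) + (1 - ∑ j ∈ s, u j) := by
    intro c
    have := Real.geom_mean_le_arith_mean_weighted (insertNone s)
      (fun o => o.elim (1 - ∑ j ∈ s, u j) u) (fun o => o.elim 1 fun j => h j c / H j)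
      (by rintro (_ | j) _ <;> simp [hsum, hu]) (by simp)
      (by rintro (_ | j) _ <;> simp [div_nonneg, hh, hH0])
    simpa [add_comm] using this
  have havg : 𝔼 c, ∏ j ∈ s, (h j c / H j) ^ u j ≤ 1 := by
    refine (expect_le_expect fun c _ => hamgm c).trans ?_
    rw [expect_add_distrib, Fintype.expect_const, expect_sum_comm]
    have : ∑ j ∈ s, 𝔼 c, u j * (h j c / H j) ≤ ∑ j ∈ s, u j := by
      refine sum_le_sum fun j _ => ?_
      rw [← mul_expect, ← expect_div]
      exact mul_le_of_le_one_right (hu j) (div_self_le_one _)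
    linarith
  calc 𝔼 c, ∏ j ∈ s, h j c ^ u j
      = (∏ j ∈ s, H j ^ u j) * 𝔼 c, ∏ j ∈ s, (h j c / H j) ^ u j := by
        rw [mul_expect]
        refine expect_congr rfl fun c _ => ?_
        rw [← prod_mul_distrib]
        exact prod_congr rfl fun j _ => hnorm j c
    _ ≤ _ := mul_le_of_le_one_right
        (prod_nonneg fun j _ => Real.rpow_nonneg (hH0 j) _) havg

/-- Resampling one coordinate does not change the average. -/
theorem expect_expect_update {V Ω : Type*} [Fintype V] [DecidableEq V] [Fintype Ω] [Nonempty Ω]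
    (v : V) (g : (V → Ω) → ℝ) : 𝔼 a, 𝔼 c, g (update a v c) = 𝔼 a, g a := by
  let e : (V → Ω) × Ω ≃ (V → Ω) × Ω :=
    Involutive.toPerm (fun z => (update z.1 v z.2, z.1 v)) (by rintro ⟨a, c⟩; simp)
  calc 𝔼 a, 𝔼 c, g (update a v c)
      = 𝔼 z : (V → Ω) × Ω, g (update z.1 v z.2) := by
        rw [← univ_product_univ, expect_product]
    _ = 𝔼 z : (V → Ω) × Ω, g z.1 := Fintype.expect_equiv e _ _ fun _ => rfl
    _ = 𝔼 a, g a := by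
        rw [← univ_product_univ, expect_product]
        exact expect_congr rfl fun a _ => Fintype.expect_const (g a)

/-- **Finner's inequality**: if `g j` depends only on the coordinates in `e j`, and `u` is a
fractional packing of the hypergraph with the edges `e j`, then the average of `∏ j, g j ^ u j` is at
most the product of the powers of the averages. -/
theorem expect_prod_rpow_le_of_dependsOn {V Ω κ : Type*} [Fintype V] [DecidableEq V] [Fintype Ω]
    [Nonempty Ω] [Fintype κ] (e : κ → Finset V) {u : κ → ℝ} (hu : ∀ j, 0 ≤ u j)
    (hpack : ∀ v, ∑ j with v ∈ e j, u j ≤ 1) (g : κ → (V → Ω) → ℝ) (hg : ∀ j a, 0 ≤ g j a)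
    (hdep : ∀ j, DependsOn (g j) (e j : Set V)) :
    𝔼 a, ∏ j, g j a ^ u j ≤ ∏ j, (𝔼 a, g j a) ^ u j := by
  -- The coordinates outside `s` have already been averaged out.
  suffices H : ∀ (s : Finset V) (g : κ → (V → Ω) → ℝ), (∀ j a, 0 ≤ g j a) →
      (∀ j, DependsOn (g j) (↑(e j ∩ s) : Set V)) →
      𝔼 a, ∏ j, g j a ^ u j ≤ ∏ j, (𝔼 a, g j a) ^ u j from
    H univ g hg (by simpa using hdep)
  intro s
  induction s using Finset.induction_on with
  | empty =>
    intro g hg hdep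
    obtain ⟨a₀⟩ : Nonempty (V → Ω) := inferInstance
    have hc : ∀ j a, g j a = g j a₀ := fun j a => hdep j (by simp)
    have hc' : ∀ j, 𝔼 a, g j a = g j a₀ := fun j => by
      simp_rw [hc j]; exact Fintype.expect_const _
    simp_rw [hc']
    refine le_of_eq ((expect_congr rfl fun a _ => ?_).trans (Fintype.expect_const _))
    exact prod_congr rfl fun j _ => by rw [hc j a]
  | insert v s hv ih =>
    intro g hg hdep
    set g' : κ → (V → Ω) → ℝ := fun j a => 𝔼 c, g j (update a v c) with hg'
    have hpoint : ∀ a, 𝔼 c, ∏ j, g j (update a v c) ^ u j ≤ ∏ j, g' j a ^ u j := by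
      intro a
      have hcon : ∀ j, v ∉ e j → ∀ c, g j (update a v c) = g j a := by
        intro j hj c
        refine hdep j fun w hw => update_of_ne ?_ _ _
        rintro rfl
        exact hj (mem_inter.1 (mem_coe.1 hw)).1
      have hcon' : ∀ j, v ∉ e j → g' j a = g j a := by
        intro j hj
        simp only [hg', hcon j hj]
        exact Fintype.expect_const _
      have hsplit : ∀ f : κ → ℝ, ∏ j, f j =
          (∏ j with v ∉ e j, f j) * ∏ j with v ∈ e j, f j := fun f => by
        rw [mul_comm, prod_filter_mul_prod_filter_not]
      simp_rw [hsplit]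
      have h1 : ∀ c, ∏ j with v ∉ e j, g j (update a v c) ^ u j
          = ∏ j with v ∉ e j, g' j a ^ u j := fun c =>
        prod_congr rfl fun j hj => by
          rw [hcon j (mem_filter.1 hj).2, hcon' j (mem_filter.1 hj).2]
      simp_rw [h1]
      rw [← mul_expect]
      refine mul_le_mul_of_nonneg_left ?_ (prod_nonneg fun j _ =>
        Real.rpow_nonneg (expect_nonneg fun c _ => hg _ _) _)
      exact expect_prod_rpow_le_prod_expect_rpow _ hu (hpack v) fun j c => hg _ _
    calc 𝔼 a, ∏ j, g j a ^ u j
        = 𝔼 a, 𝔼 c, ∏ j, g j (update a v c) ^ u j :=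
          (expect_expect_update v fun a => ∏ j, g j a ^ u j).symm
      _ ≤ 𝔼 a, ∏ j, g' j a ^ u j := expect_le_expect fun a _ => hpoint a
      _ ≤ ∏ j, (𝔼 a, g' j a) ^ u j := by
          refine ih g' (fun j a => expect_nonneg fun c _ => hg _ _) fun j a b hab => ?_
          refine expect_congr rfl fun c _ => hdep j fun w hw => ?_
          rcases eq_or_ne w v with rfl | hwv
          · simp
          · rw [update_of_ne hwv, update_of_ne hwv]
            refine hab w ?_
            simp only [coe_inter, Set.mem_inter_iff, mem_coe, mem_insert] at hw ⊢
            exact ⟨hw.1, hw.2.resolve_left hwv⟩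
      _ = ∏ j, (𝔼 a, g j a) ^ u j := by simp_rw [hg', expect_expect_update]

end Finner

/-! ### Bit strings and what a message reveals -/

section Messages

open Finset
open scoped BigOperators

/-- There are `2 ^ (L + 1) - 1` bit strings of length at most `L`; the bound `4 ^ L` is also correct
for `L = 0`, where only the empty message is left. -/
theorem card_le_four_pow_of_length_le {T : Finset (List Bool)} {L : ℕ}
    (hT : ∀ l ∈ T, l.length ≤ L) : T.card ≤ 4 ^ L := by
  classical
  have h1 : T.card ≤ ∑ i ∈ range (L + 1), 2 ^ i := by
    rw [card_eq_sum_card_fiberwise (f := List.length) (t := range (L + 1))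
      fun l hl => by simpa [Nat.lt_succ_iff] using hT l hl]
    exact sum_le_sum fun i _ => by simpa using card_filter_length_eq_le (α := Bool) (T := T) (s := i)
  have h2 : ∀ L : ℕ, ∑ i ∈ range (L + 1), 2 ^ i ≤ 4 ^ L := by
    intro L
    induction L with
    | zero => simp
    | succ L ih =>
      have h3 : 2 ^ (L + 1) ≤ 2 * 4 ^ L := by
        rw [pow_succ, mul_comm]
        exact Nat.mul_le_mul_left 2 (Nat.pow_le_pow_left (by norm_num) L)
      rw [sum_range_succ, pow_succ 4]
      omega
  exact h1.trans (h2 L)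

/-- The entropy of `f` on the uniform space `F` is at most the logarithm of the number of values. -/
theorem sum_log_card_div_card_fiber_le {σ β : Type*} [DecidableEq β] (F : Finset σ) (f : σ → β) :
    ∑ S ∈ F, Real.log (F.card / {S' ∈ F | f S' = f S}.card)
      ≤ F.card * Real.log (F.image f).card := by
  rcases F.eq_empty_or_nonempty with rfl | hF
  · simp
  set N : ℝ := (F.card : ℝ)
  set Q : ℝ := ((F.image f).card : ℝ)
  have hN : 0 < N := Nat.cast_pos.2 hF.card_pos
  have hQ : 0 < Q := Nat.cast_pos.2 (hF.image f).card_pos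
  have hc : ∀ S ∈ F, (0 : ℝ) < {S' ∈ F | f S' = f S}.card := fun S hS =>
    Nat.cast_pos.2 (card_pos.2 ⟨S, by simp [hS]⟩)
  have hinv : ∑ S ∈ F, (1 : ℝ) / {S' ∈ F | f S' = f S}.card = Q := by
    rw [← sum_fiberwise_of_maps_to (t := F.image f) (g := f) fun S hS => mem_image_of_mem f hS]
    have : ∀ b ∈ F.image f, ∑ S ∈ F with f S = b, (1 : ℝ) / {S' ∈ F | f S' = f S}.card = 1 := by
      intro b hb
      obtain ⟨S, hS, rfl⟩ := mem_image.1 hb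
      rw [sum_congr rfl fun T hT => by rw [(mem_filter.1 hT).2], sum_const, nsmul_eq_mul,
        mul_one_div_cancel (hc S hS).ne']
    rw [sum_congr rfl this]
    simp [Q]
  -- Jensen's inequality in the form `log y ≤ y - 1`, taken at the mean `Q`.
  have hlog : ∀ S ∈ F, Real.log (N / {S' ∈ F | f S' = f S}.card)
      ≤ Real.log Q + (N / Q * (1 / {S' ∈ F | f S' = f S}.card) - 1) := by
    intro S hS
    have h1 := Real.log_le_sub_one_of_pos (div_pos (div_pos hN (hc S hS)) hQ)
    rw [Real.log_div (div_pos hN (hc S hS)).ne' hQ.ne'] at h1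
    have h2 : N / {S' ∈ F | f S' = f S}.card / Q = N / Q * (1 / {S' ∈ F | f S' = f S}.card) := by
      field_simp
    linarith
  refine (sum_le_sum hlog).trans (le_of_eq ?_)
  rw [sum_add_distrib, sum_sub_distrib, ← mul_sum, hinv, div_mul_cancel₀ _ hQ.ne']
  simp [N]

variable {τ β : Type*} [Fintype τ] [DecidableEq τ]

/-- The elements that belong to every set of the family `F` with the same message as `S`: what the
receiver of the message `f S` knows to be in the set. -/
noncomputable def knownPart (F : Finset (Finset τ)) (f : Finset τ → β) (S : Finset τ) : Finset τ :=
  open Classical in {t | ∀ S' ∈ F, f S' = f S → t ∈ S'}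

theorem knownPart_subset {F : Finset (Finset τ)} {f : Finset τ → β} {S S' : Finset τ}
    (hS' : S' ∈ F) (h : f S' = f S) : knownPart F f S ⊆ S' := fun t ht => by
  simp only [knownPart, mem_filter, mem_univ, true_and] at ht
  exact ht S' hS' h

/-- If `k` prescribed elements lie in at most a fraction `n ^ (-k / 2)` of the sets of a family, then
a message of at most `L` bits reveals at most `4 L / log₂ n` elements on average. -/
theorem expect_card_knownPart_mul_logb_le {F : Finset (Finset τ)} (hF : F.Nonempty) {n L : ℕ}
    (hn : 0 < n)
    (hext : ∀ S ∈ F, ∀ K ⊆ S, n ^ K.card * {S' ∈ F | K ⊆ S'}.card ^ 2 ≤ F.card ^ 2)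
    (f : Finset τ → List Bool) (hf : ∀ S ∈ F, (f S).length ≤ L) :
    (𝔼 S ∈ F, ((knownPart F f S).card : ℝ)) * Real.logb 2 n ≤ 4 * L := by
  have hN : (0 : ℝ) < F.card := Nat.cast_pos.2 hF.card_pos
  have hpoint : ∀ S ∈ F, ((knownPart F f S).card : ℝ) * Real.log n
      ≤ 2 * Real.log (F.card / {S' ∈ F | f S' = f S}.card) := by
    intro S hS
    have hc : (0 : ℝ) < {S' ∈ F | f S' = f S}.card := Nat.cast_pos.2 (card_pos.2 ⟨S, by simp [hS]⟩)
    have hle : {S' ∈ F | f S' = f S}.card ≤ {S' ∈ F | knownPart F f S ⊆ S'}.card :=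
      card_le_card fun S' hS' => by
        rw [mem_filter] at hS' ⊢
        exact ⟨hS'.1, knownPart_subset hS'.1 hS'.2⟩
    have h1 : n ^ (knownPart F f S).card * {S' ∈ F | f S' = f S}.card ^ 2 ≤ F.card ^ 2 :=
      (Nat.mul_le_mul_left _ (Nat.pow_le_pow_left hle 2)).trans
        (hext S hS _ (knownPart_subset hS rfl))
    have h2 : (n : ℝ) ^ (knownPart F f S).card ≤ (F.card / {S' ∈ F | f S' = f S}.card : ℝ) ^ 2 := by
      rw [div_pow, le_div_iff₀ (pow_pos hc 2)]
      exact_mod_cast h1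
    have h3 := Real.log_le_log (pow_pos (Nat.cast_pos.2 hn) _) h2
    rwa [Real.log_pow, Real.log_pow, Nat.cast_ofNat] at h3
  have hQ : Real.log (F.image f).card ≤ L * (2 * Real.log 2) := by
    have h4 : ((F.image f).card : ℝ) ≤ 4 ^ L := by
      exact_mod_cast card_le_four_pow_of_length_le (T := F.image f) (L := L) (by simpa using hf)
    have h5 := Real.log_le_log (Nat.cast_pos.2 (hF.image f).card_pos) h4
    rw [Real.log_pow] at h5
    have h6 : Real.log 4 = 2 * Real.log 2 := by
      rw [← Real.log_rpow two_pos]; norm_num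
    rwa [h6] at h5
  have hsum : (∑ S ∈ F, ((knownPart F f S).card : ℝ)) * Real.log n
      ≤ 2 * (F.card * (L * (2 * Real.log 2))) := by
    rw [sum_mul]
    refine (sum_le_sum hpoint).trans ?_
    rw [← mul_sum]
    have := sum_log_card_div_card_fiber_le F f
    have := mul_le_mul_of_nonneg_left hQ hN.le
    linarith
  have hlog2 : 0 < Real.log 2 := Real.log_pos one_lt_two
  rw [expect_eq_sum_div_card, Real.logb, div_mul_div_comm, div_le_iff₀ (mul_pos hN hlog2)]
  linarith

end Messages

/-! ### Symmetries of the skewed instances -/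

namespace ConjunctiveQuery

open Finset Function
open scoped BigOperators

variable {V ι : Type*}

theorem var_mem_atom (q : ConjunctiveQuery V ι) (j : ι) (i : Fin (q.arity j)) :
    q.var j i ∈ q.atom j :=
  List.get_mem _ _

theorem exists_var_eq {q : ConjunctiveQuery V ι} {j : ι} {v : V} (hv : v ∈ q.atom j) :
    ∃ i, q.var j i = v :=
  List.get_of_mem hv

variable [DecidableEq V]

/-- The assignment that takes the value `α` on `x` and agrees with `b` elsewhere. All answers that
the lower bound counts are of this form. -/
def pin {n : ℕ} (x : Finset V) (α : Fin n) (b : V → Fin n) : V → Fin n :=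
  fun v => if v ∈ x then α else b v

/-- The tuple that the assignment `pin x α b` prescribes for the `j`-th atom. -/
def pinnedTuple (q : ConjunctiveQuery V ι) {n : ℕ} (x : Finset V) (α : Fin n) (j : ι)
    (b : V → Fin n) : q.Tuple n j :=
  fun i => pin x α b (q.var j i)

/-- The action on tuples of one permutation of the domain for every variable; the positions with
variables in `x` are left unchanged. -/
def relabel (q : ConjunctiveQuery V ι) {n : ℕ} (x : Finset V) (π : V → Equiv.Perm (Fin n)) (j : ι) :
    Equiv.Perm (q.Tuple n j) :=
  Equiv.piCongrRight fun i => if q.var j i ∈ x then Equiv.refl _ else π (q.var j i)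

variable {q : ConjunctiveQuery V ι} {n m : ℕ} {x : Finset V} {α : Fin n} {j : ι}

theorem relabel_apply_of_mem (π : V → Equiv.Perm (Fin n)) (t : q.Tuple n j) {i : Fin (q.arity j)}
    (hi : q.var j i ∈ x) : q.relabel x π j t i = t i := by
  simp [relabel, hi]

theorem relabel_apply_of_notMem (π : V → Equiv.Perm (Fin n)) (t : q.Tuple n j)
    {i : Fin (q.arity j)} (hi : q.var j i ∉ x) :
    q.relabel x π j t i = π (q.var j i) (t i) := by
  simp [relabel, hi]

theorem relabel_symm (π : V → Equiv.Perm (Fin n)) :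
    (q.relabel x π j).symm = q.relabel x (fun v => (π v).symm) j := by
  ext t i : 2
  by_cases hi : q.var j i ∈ x <;> simp [relabel, hi]

theorem relabel_pinnedTuple (π : V → Equiv.Perm (Fin n)) (b : V → Fin n) :
    q.relabel x π j (q.pinnedTuple x α j b) = q.pinnedTuple x α j fun v => π v (b v) := by
  ext i : 1
  by_cases hi : q.var j i ∈ x
  · rw [relabel_apply_of_mem _ _ hi]; simp [pinnedTuple, pin, hi]
  · rw [relabel_apply_of_notMem _ _ hi]; simp [pinnedTuple, pin, hi]

theorem card_of_mem_skewRelations {S : Finset (q.Tuple n j)} (hS : S ∈ q.skewRelations x α m j) :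
    S.card = m := by
  simp only [skewRelations, mem_filter] at hS
  exact hS.2.1

theorem mem_skewRelations_iff_of_exists (h : ∃ v ∈ q.atom j, v ∉ x) {S : Finset (q.Tuple n j)} :
    S ∈ q.skewRelations x α m j ↔ S.card = m ∧
      (∀ t ∈ S, ∀ i, q.var j i ∈ x → t i = α) ∧
      (∀ t ∈ S, ∀ i i', q.var j i = q.var j i' → t i = t i') ∧
      (∀ t ∈ S, ∀ t' ∈ S, ∀ i, q.var j i ∉ x → t i = t' i → t = t') := by
  simp only [skewRelations, mem_filter, mem_univ, true_and, if_pos h]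

theorem map_relabel_mem_skewRelations (π : V → Equiv.Perm (Fin n)) {S : Finset (q.Tuple n j)}
    (hS : S ∈ q.skewRelations x α m j) :
    S.map (q.relabel x π j).toEmbedding ∈ q.skewRelations x α m j := by
  by_cases h : ∃ v ∈ q.atom j, v ∉ x
  · rw [mem_skewRelations_iff_of_exists h] at hS ⊢
    obtain ⟨hc, hα, heq, hinj⟩ := hS
    simp only [card_map, forall_mem_map, Equiv.coe_toEmbedding]
    refine ⟨hc, fun t ht i hi => ?_, fun t ht i i' hi => ?_, fun t ht t' ht' i hi htt => ?_⟩
    · rw [relabel_apply_of_mem _ _ hi, hα t ht i hi]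
    · by_cases hx : q.var j i ∈ x
      · rw [relabel_apply_of_mem _ _ hx, relabel_apply_of_mem _ _ (hi ▸ hx), heq t ht i i' hi]
      · rw [relabel_apply_of_notMem _ _ hx, relabel_apply_of_notMem _ _ (hi ▸ hx),
          heq t ht i i' hi, hi]
    · rw [relabel_apply_of_notMem _ _ hi, relabel_apply_of_notMem _ _ hi] at htt
      rw [hinj t ht t' ht' i hi ((π _).injective htt)]
  · have hid : q.relabel x π j = Equiv.refl _ := by
      push Not at h
      ext t i : 2
      exact relabel_apply_of_mem _ _ (h _ (q.var_mem_atom j i))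
    rw [hid]
    simpa using hS

/-- Relabelling the values does not change the number of relations that contain given tuples. -/
theorem card_filter_map_relabel_subset (π : V → Equiv.Perm (Fin n)) (T : Finset (q.Tuple n j)) :
    {S ∈ q.skewRelations x α m j | T.map (q.relabel x π j).toEmbedding ⊆ S}.card
      = {S ∈ q.skewRelations x α m j | T ⊆ S}.card := by
  symm
  refine card_equiv (q.relabel x π j).finsetCongr fun S => ?_
  simp only [mem_filter, Equiv.finsetCongr_apply, map_subset_map]
  refine and_congr_left fun _ => ⟨map_relabel_mem_skewRelations π, fun h => ?_⟩
  have := map_relabel_mem_skewRelations (fun v => (π v).symm) h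
  rw [← relabel_symm, map_map] at this
  convert this
  ext t
  simp

/-! ### How rarely prescribed tuples occur in a random matching -/

/-- The conditional probability that a random matching contains `t`, given that it contains `K`, is
at most `m / n`. Indeed the value of `t` at a variable outside `x` can be exchanged for each of the
`n - |K|` values that do not occur in `K`, and only `m - |K|` of the resulting tuples can be in the
same matching. -/
theorem mul_card_filter_insert_subset_le (h : ∃ v ∈ q.atom j, v ∉ x) (hmn : m ≤ n)
    {S : Finset (q.Tuple n j)} (hS : S ∈ q.skewRelations x α m j) {t : q.Tuple n j}
    {K : Finset (q.Tuple n j)} (htK : t ∉ K) (hK : insert t K ⊆ S) :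
    n * {S' ∈ q.skewRelations x α m j | insert t K ⊆ S'}.card
      ≤ m * {S' ∈ q.skewRelations x α m j | K ⊆ S'}.card := by
  obtain ⟨v, hv, hvx⟩ := h
  have hS' := (mem_skewRelations_iff_of_exists ⟨v, hv, hvx⟩).1 hS
  obtain ⟨hc, -, heq, hinj⟩ := hS'
  obtain ⟨i, rfl⟩ := exists_var_eq hv
  set F := q.skewRelations x α m j
  have htS : t ∈ S := hK (mem_insert_self _ _)
  have hKS : K ⊆ S := (subset_insert _ _).trans hK
  set C : Finset (Fin n) := univ \ K.image fun t' => t' i with hC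
  have hCcard : n - K.card ≤ C.card := by
    rw [hC, card_sdiff_of_subset (subset_univ _), card_univ, Fintype.card_fin]
    exact Nat.sub_le_sub_left card_image_le n
  let π : Fin n → V → Equiv.Perm (Fin n) := fun c => update 1 (q.var j i) (Equiv.swap (t i) c)
  let τ : Fin n → q.Tuple n j := fun c => q.relabel x (π c) j t
  have hτi : ∀ c, τ c i = c := fun c => by
    simp only [τ]
    rw [relabel_apply_of_notMem _ _ hvx]
    simp [π]
  have hfix : ∀ c ∈ C, ∀ t' ∈ K, q.relabel x (π c) j t' = t' := by
    intro c hcC t' ht'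
    ext i' : 1
    by_cases hx : q.var j i' ∈ x
    · exact relabel_apply_of_mem _ _ hx
    · rw [relabel_apply_of_notMem _ _ hx]
      by_cases hvi : q.var j i' = q.var j i
      · simp only [π, hvi, update_self]
        rw [heq t' (hKS ht') i' i hvi]
        refine Equiv.swap_apply_of_ne_of_ne (fun he => htK ?_) fun he => ?_
        · rwa [← hinj t' (hKS ht') t htS i hvx he]
        · rw [hC, mem_sdiff] at hcC
          exact hcC.2 (mem_image.2 ⟨t', ht', he⟩)
      · simp [π, update_of_ne hvi]
  have hmap : ∀ c ∈ C, (insert t K).map (q.relabel x (π c) j).toEmbedding = insert (τ c) K := by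
    intro c hcC
    rw [map_insert]
    congr 1
    ext t'
    simp only [mem_map, Equiv.coe_toEmbedding]
    exact ⟨fun ⟨a, ha, hat⟩ => by rw [← hat, hfix c hcC a ha]; exact ha,
      fun ht' => ⟨t', ht', hfix c hcC t' ht'⟩⟩
  have hsame : ∀ c ∈ C, {S' ∈ F | insert (τ c) K ⊆ S'}.card = {S' ∈ F | insert t K ⊆ S'}.card := by
    intro c hcC
    rw [← hmap c hcC, card_filter_map_relabel_subset]
  have hkm : K.card < m := by
    rw [← hc, ← Nat.succ_le_iff, ← Nat.add_one, ← card_insert_of_notMem htK]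
    exact card_le_card hK
  -- Double counting of the pairs of a value `c` and a matching that contains `K` and `τ c`.
  have hcount : C.card * {S' ∈ F | insert t K ⊆ S'}.card
      ≤ {S' ∈ F | K ⊆ S'}.card * (m - K.card) := by
    refine card_mul_le_card_mul (fun c S' => τ c ∈ S') (fun c hcC => ?_) fun S' hS' => ?_
    · rw [← hsame c hcC]
      refine card_le_card fun S' hS' => ?_
      rw [mem_filter, insert_subset_iff] at hS'
      rw [mem_bipartiteAbove, mem_filter]
      exact ⟨⟨hS'.1, hS'.2.2⟩, hS'.2.1⟩
    · rw [mem_filter] at hS'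
      rw [← card_of_mem_skewRelations hS'.1, ← card_sdiff_of_subset hS'.2]
      refine card_le_card_of_injOn τ (fun c hcS => ?_) fun c _ d _ hcd => ?_
      · rw [mem_coe, mem_bipartiteBelow] at hcS
        rw [mem_coe, mem_sdiff]
        refine ⟨hcS.2, fun hτK => ?_⟩
        have := hcS.1
        rw [hC, mem_sdiff] at this
        exact this.2 (mem_image.2 ⟨τ c, hτK, hτi c⟩)
      · rw [← hτi c, ← hτi d, hcd]
  have hmul : n * (m - K.card) ≤ m * (n - K.card) := by
    rw [Nat.mul_sub, Nat.mul_sub, mul_comm m n]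
    exact Nat.sub_le_sub_left (Nat.mul_le_mul_right _ hmn) _
  refine Nat.le_of_mul_le_mul_left ?_ (Nat.sub_pos_of_lt (hkm.trans_le hmn))
  calc (n - K.card) * (n * {S' ∈ F | insert t K ⊆ S'}.card)
      ≤ C.card * (n * {S' ∈ F | insert t K ⊆ S'}.card) := Nat.mul_le_mul_right _ hCcard
    _ = n * (C.card * {S' ∈ F | insert t K ⊆ S'}.card) := by ring
    _ ≤ n * ({S' ∈ F | K ⊆ S'}.card * (m - K.card)) := Nat.mul_le_mul_left _ hcount
    _ = n * (m - K.card) * {S' ∈ F | K ⊆ S'}.card := by ring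
    _ ≤ m * (n - K.card) * {S' ∈ F | K ⊆ S'}.card := Nat.mul_le_mul_right _ hmul
    _ = (n - K.card) * (m * {S' ∈ F | K ⊆ S'}.card) := by ring

theorem pow_mul_card_filter_subset_le (h : ∃ v ∈ q.atom j, v ∉ x) (hmn : m ≤ n)
    {S : Finset (q.Tuple n j)} (hS : S ∈ q.skewRelations x α m j) (K : Finset (q.Tuple n j)) :
    K ⊆ S → n ^ K.card * {S' ∈ q.skewRelations x α m j | K ⊆ S'}.card
      ≤ m ^ K.card * (q.skewRelations x α m j).card := by
  induction K using Finset.induction_on with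
  | empty => simp
  | insert t K ht ih =>
    intro hK
    have h1 := mul_card_filter_insert_subset_le h hmn hS ht hK
    have h2 := ih ((subset_insert _ _).trans hK)
    rw [card_insert_of_notMem ht, pow_succ, pow_succ, mul_assoc]
    refine (Nat.mul_le_mul_left _ h1).trans ?_
    rw [mul_left_comm, mul_right_comm, mul_comm _ m]
    exact Nat.mul_le_mul_left _ h2

/-- For `m ^ 2 ≤ n`, a random matching contains `k` prescribed tuples with probability at most
`n ^ (-k / 2)`. -/
theorem pow_mul_card_filter_subset_sq_le (h : ∃ v ∈ q.atom j, v ∉ x) (hmn : m ^ 2 ≤ n)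
    {S : Finset (q.Tuple n j)} (hS : S ∈ q.skewRelations x α m j) {K : Finset (q.Tuple n j)}
    (hK : K ⊆ S) :
    n ^ K.card * {S' ∈ q.skewRelations x α m j | K ⊆ S'}.card ^ 2
      ≤ (q.skewRelations x α m j).card ^ 2 := by
  have h1 := pow_mul_card_filter_subset_le h ((Nat.le_self_pow two_ne_zero m).trans hmn) hS K hK
  have h2 := Nat.pow_le_pow_left h1 2
  have h3 := Nat.pow_le_pow_left hmn K.card
  refine Nat.le_of_mul_le_mul_left ?_ (pow_pos α.pos K.card)
  calc n ^ K.card * (n ^ K.card * {S' ∈ q.skewRelations x α m j | K ⊆ S'}.card ^ 2)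
      = (n ^ K.card * {S' ∈ q.skewRelations x α m j | K ⊆ S'}.card) ^ 2 := by ring
    _ ≤ (m ^ K.card * (q.skewRelations x α m j).card) ^ 2 := h2
    _ = (m ^ 2) ^ K.card * (q.skewRelations x α m j).card ^ 2 := by ring
    _ ≤ n ^ K.card * (q.skewRelations x α m j).card ^ 2 := Nat.mul_le_mul_right _ h3

/-! ### The probability that a pinned tuple is in a random relation -/

/-- The probability that the random `j`-th relation contains the tuple of the assignment `b`. -/
noncomputable def tupleProb (q : ConjunctiveQuery V ι) {n : ℕ} (x : Finset V) (α : Fin n) (m : ℕ)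
    (j : ι) (b : V → Fin n) : ℝ :=
  𝔼 S ∈ q.skewRelations x α m j, if q.pinnedTuple x α j b ∈ S then 1 else 0

theorem tupleProb_eq (b b' : V → Fin n) : q.tupleProb x α m j b = q.tupleProb x α m j b' := by
  have h := card_filter_map_relabel_subset (q := q) (x := x) (α := α) (m := m) (j := j)
    (fun v => Equiv.swap (b v) (b' v)) {q.pinnedTuple x α j b}
  simp only [map_singleton, Equiv.coe_toEmbedding, relabel_pinnedTuple, Equiv.swap_apply_left,
    singleton_subset_iff] at h
  simp only [tupleProb, expect_eq_sum_div_card, sum_boole]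
  rw [h]

/-- The tuples of the matchings come from assignments. -/
theorem exists_pinnedTuple_eq (h : ∃ v ∈ q.atom j, v ∉ x) {S : Finset (q.Tuple n j)}
    (hS : S ∈ q.skewRelations x α m j) {t : q.Tuple n j} (ht : t ∈ S) :
    ∃ b, q.pinnedTuple x α j b = t := by
  classical
  obtain ⟨-, hα, heq, -⟩ := (mem_skewRelations_iff_of_exists h).1 hS
  refine ⟨fun v => if hv : ∃ i, q.var j i = v then t hv.choose else α, ?_⟩
  ext i : 1
  by_cases hi : q.var j i ∈ x
  · simp [pinnedTuple, pin, hi, hα t ht i hi]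
  · have hex : ∃ i', q.var j i' = q.var j i := ⟨i, rfl⟩
    simp only [pinnedTuple, pin, hi, if_false, hex, dif_pos]
    exact heq t ht _ _ hex.choose_spec

theorem tupleProb_pos (hm : 0 < m) (hn : m ≤ n) (b : V → Fin n) : 0 < q.tupleProb x α m j b := by
  obtain ⟨S, hS⟩ := q.skewRelations_nonempty x α hm hn j
  obtain ⟨b', hb'⟩ : ∃ b', q.pinnedTuple x α j b' ∈ S := by
    by_cases h : ∃ v ∈ q.atom j, v ∉ x
    · obtain ⟨t, ht⟩ := card_pos.1 (hm.trans_eq (card_of_mem_skewRelations hS).symm)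
      obtain ⟨b', rfl⟩ := exists_pinnedTuple_eq h hS ht
      exact ⟨b', ht⟩
    · refine ⟨b, ?_⟩
      have h1 := hS
      simp only [skewRelations, mem_filter, mem_univ, true_and, if_neg h] at h1
      convert h1.2.1 with i
      push Not at h
      simp [pinnedTuple, pin, h _ (q.var_mem_atom j i)]
  rw [tupleProb_eq b b', tupleProb]
  exact expect_pos' (fun S _ => by split_ifs <;> simp) ⟨S, hS, by simp [hb']⟩

/-- Every tuple of a matching is the tuple of equally many assignments. Hence, if `K S` is a part of
the matching `S`, then a random assignment has its tuple in `K S`, rather than in `S`, in the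
proportion of the average cardinalities. -/
theorem expect_pinnedTuple_mem_mul [Fintype V] (h : ∃ v ∈ q.atom j, v ∉ x)
    (hF : (q.skewRelations x α m j).Nonempty) (K : Finset (q.Tuple n j) → Finset (q.Tuple n j))
    (hK : ∀ S ∈ q.skewRelations x α m j, K S ⊆ S) (b₀ : V → Fin n) :
    (𝔼 b, 𝔼 S ∈ q.skewRelations x α m j, if q.pinnedTuple x α j b ∈ K S then (1 : ℝ) else 0) * m
      = q.tupleProb x α m j b₀ * 𝔼 S ∈ q.skewRelations x α m j, ((K S).card : ℝ) := by
  have : Nonempty (Fin n) := ⟨α⟩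
  set φ : ℝ := 𝔼 b, if q.pinnedTuple x α j b = q.pinnedTuple x α j b₀ then (1 : ℝ) else 0 with hφ
  have hfib : ∀ b', (𝔼 b, if q.pinnedTuple x α j b = q.pinnedTuple x α j b' then (1 : ℝ) else 0)
      = φ := by
    intro b'
    rw [hφ]
    refine Fintype.expect_equiv
      (Equiv.piCongrRight fun v => Equiv.swap (b' v) (b₀ v)) _ _ fun b => ?_
    have h1 := relabel_pinnedTuple (q := q) (x := x) (α := α) (j := j)
      (fun v => Equiv.swap (b' v) (b₀ v)) b
    have h2 := relabel_pinnedTuple (q := q) (x := x) (α := α) (j := j)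
      (fun v => Equiv.swap (b' v) (b₀ v)) b'
    simp only [Equiv.swap_apply_left] at h2
    have h3 : q.pinnedTuple x α j b = q.pinnedTuple x α j b' ↔
        q.pinnedTuple x α j (Equiv.piCongrRight (fun v => Equiv.swap (b' v) (b₀ v)) b)
          = q.pinnedTuple x α j b₀ := by
      rw [← (q.relabel x (fun v => Equiv.swap (b' v) (b₀ v)) j).injective.eq_iff, h1, h2]
      rfl
    simp only [h3]
  have hpart : ∀ K : Finset (q.Tuple n j) → Finset (q.Tuple n j),
      (∀ S ∈ q.skewRelations x α m j, K S ⊆ S) →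
      (𝔼 b, 𝔼 S ∈ q.skewRelations x α m j, if q.pinnedTuple x α j b ∈ K S then (1 : ℝ) else 0)
        = φ * 𝔼 S ∈ q.skewRelations x α m j, ((K S).card : ℝ) := by
    intro K hK
    rw [expect_comm, mul_expect]
    refine expect_congr rfl fun S hS => ?_
    have h1 : ∀ b, (if q.pinnedTuple x α j b ∈ K S then (1 : ℝ) else 0)
        = ∑ t ∈ K S, if q.pinnedTuple x α j b = t then (1 : ℝ) else 0 := fun b => by simp
    simp_rw [h1]
    rw [expect_sum_comm, mul_comm, ← nsmul_eq_mul, ← sum_const]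
    refine sum_congr rfl fun t ht => ?_
    obtain ⟨b', rfl⟩ := exists_pinnedTuple_eq h hS (hK S hS ht)
    exact hfib b'
  have hall := hpart (fun S => S) fun _ _ => Subset.rfl
  have h4 : (𝔼 b, 𝔼 S ∈ q.skewRelations x α m j,
      if q.pinnedTuple x α j b ∈ S then (1 : ℝ) else 0) = q.tupleProb x α m j b₀ :=
    (expect_congr rfl fun b _ => tupleProb_eq b b₀).trans (Fintype.expect_const _)
  have h5 : 𝔼 S ∈ q.skewRelations x α m j, (S.card : ℝ) = m :=
    (expect_congr rfl fun S hS => by rw [card_of_mem_skewRelations hS]).trans (expect_const hF _)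
  rw [h4, h5] at hall
  rw [hpart K hK, hall]
  ring

end ConjunctiveQuery

/-! ### From the knowledge of the servers to the load -/

namespace ConjunctiveQuery

open Finset Function
open scoped BigOperators

section Correctness

variable {V ι : Type*} [DecidableEq V]

/-- The probability that server `s` knows, from its message about the random `j`-th relation, that
the tuple of the assignment `b` is in this relation. -/
noncomputable def knownProb {q : ConjunctiveQuery V ι} {n p : ℕ} (A : q.OneRoundAlgorithm n p)
    (x : Finset V) (α : Fin n) (m : ℕ) (s : Fin p) (j : ι) (b : V → Fin n) : ℝ :=
  𝔼 S ∈ q.skewRelations x α m j,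
    if q.pinnedTuple x α j b ∈ knownPart (q.skewRelations x α m j) (fun S => A.msg j S s) S
    then 1 else 0

variable {q : ConjunctiveQuery V ι} {n p : ℕ} {A : q.OneRoundAlgorithm n p} {x : Finset V}
  {α : Fin n}

theorem knownProb_nonneg (m : ℕ) (s : Fin p) (j : ι) (b : V → Fin n) :
    0 ≤ knownProb A x α m s j b :=
  expect_nonneg fun S _ => by split_ifs <;> simp

theorem knownProb_le_tupleProb (m : ℕ) (s : Fin p) (j : ι) (b : V → Fin n) :
    knownProb A x α m s j b ≤ q.tupleProb x α m j b :=
  expect_le_expect fun S hS => by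
    have hsub : knownPart (q.skewRelations x α m j) (fun S => A.msg j S s) S ⊆ S :=
      knownPart_subset hS rfl
    by_cases h : q.pinnedTuple x α j b ∈ S
    · rw [if_pos h]; split_ifs <;> simp
    · rw [if_neg h, if_neg fun h' => h (hsub h')]

theorem dependsOn_knownProb (m : ℕ) (s : Fin p) (j : ι) :
    DependsOn (knownProb A x α m s j) (↑((q.atom j).toFinset \ x) : Set V) := fun b b' h => by
  have : q.pinnedTuple x α j b = q.pinnedTuple x α j b' := by
    ext i : 1
    by_cases hi : q.var j i ∈ x
    · simp [pinnedTuple, pin, hi]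
    · simp only [pinnedTuple, pin, hi, if_false]
      exact h _ (by simpa [hi] using q.var_mem_atom j i)
  simp only [knownProb, this]

variable [Fintype ι] [DecidableEq ι]

/-- The average over independent choices of a product is the product of the averages. -/
theorem expect_piFinset_prod {σ : ι → Type*} (F : ∀ j, Finset (σ j)) (f : ∀ j, σ j → ℝ) :
    𝔼 I ∈ Fintype.piFinset F, ∏ j, f j (I j) = ∏ j, 𝔼 S ∈ F j, f j S := by
  simp only [expect_eq_sum_div_card, prod_div_distrib, prod_univ_sum, Fintype.card_piFinset,
    Nat.cast_prod]

/-- An answer that a server outputs is correct on all instances with the same messages. As the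
messages concern one relation each, the server knows all tuples of the answer. -/
theorem exists_forall_pinnedTuple_mem_knownPart {m : ι → ℕ}
    (hA : ∀ I ∈ q.skewFamily m x α, A.ComputesOn I) {I : q.Instance n}
    (hI : I ∈ q.skewFamily m x α) {b : V → Fin n} (hb : ∀ j, q.pinnedTuple x α j b ∈ I j) :
    ∃ s, ∀ j, q.pinnedTuple x α j b
      ∈ knownPart (q.skewRelations x α (m j) j) (fun S => A.msg j S s) (I j) := by
  have hans : pin x α b ∈ q.answers I := hb
  rw [← hA I hI, Set.mem_iUnion] at hans
  obtain ⟨s, hs⟩ := hans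
  refine ⟨s, fun j => ?_⟩
  simp only [knownPart, mem_filter, mem_univ, true_and]
  intro S hS hmsg
  rw [skewFamily, Fintype.mem_piFinset] at hI
  have hI' : update I j S ∈ q.skewFamily m x α := by
    rw [skewFamily, Fintype.mem_piFinset]
    intro i
    rcases eq_or_ne i j with rfl | hij
    · rwa [update_self]
    · rw [update_of_ne hij]; exact hI i
  have hsame : (fun i => A.msg i (update I j S i) s) = fun i => A.msg i (I i) s := by
    ext1 i
    rcases eq_or_ne i j with rfl | hij
    · rwa [update_self]
    · rw [update_of_ne hij]
  have hout : pin x α b ∈ q.answers (update I j S) := by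
    rw [← hA _ hI', Set.mem_iUnion]
    exact ⟨s, by rw [hsame]; exact hs⟩
  have := hout j
  rwa [update_self] at this

/-- The probability that an assignment yields an answer is at most the expected number of servers
that know it to be one. -/
theorem prod_tupleProb_le_sum_prod_knownProb {m : ι → ℕ}
    (hA : ∀ I ∈ q.skewFamily m x α, A.ComputesOn I) (b : V → Fin n) :
    ∏ j, q.tupleProb x α (m j) j b ≤ ∑ s, ∏ j, knownProb A x α (m j) s j b := by
  simp only [tupleProb, knownProb]
  simp_rw [← expect_piFinset_prod]
  rw [← expect_sum_comm]
  refine expect_le_expect fun I hI => ?_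
  have hnn : ∀ s : Fin p, 0 ≤ ∏ j, if q.pinnedTuple x α j b
      ∈ knownPart (q.skewRelations x α (m j) j) (fun S => A.msg j S s) (I j) then (1 : ℝ) else 0 :=
    fun s => prod_nonneg fun j _ => by split_ifs <;> simp
  by_cases hb : ∀ j, q.pinnedTuple x α j b ∈ I j
  · obtain ⟨s, hs⟩ := exists_forall_pinnedTuple_mem_knownPart hA hI hb
    refine le_trans (le_of_eq ?_) (single_le_sum (fun s _ => hnn s) (mem_univ s))
    rw [prod_congr rfl fun j _ => if_pos (hb j), prod_congr rfl fun j _ => if_pos (hs j)]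
  · push Not at hb
    obtain ⟨j, hj⟩ := hb
    rw [prod_eq_zero (mem_univ j) (if_neg hj)]
    exact sum_nonneg fun s _ => hnn s

variable [Fintype V]

/-- By Finner's inequality, the servers can only know all answers if the fractions of the relations
that they know satisfy this inequality for every fractional edge packing `u` of the residual query
(extended by `0` to the atoms that are dropped). -/
theorem one_le_sum_prod_rpow {m : ι → ℕ} (hm : ∀ j, 0 < m j) (hn : ∀ j, m j ≤ n)
    (hA : ∀ I ∈ q.skewFamily m x α, A.ComputesOn I) {u : ι → ℝ} (hu : ∀ j, 0 ≤ u j)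
    (hpack : ∀ v, v ∉ x → ∑ j with v ∈ q.atom j, u j ≤ 1)
    (hdrop : ∀ j, (¬∃ v ∈ q.atom j, v ∉ x) → u j = 0) :
    1 ≤ ∑ s, ∏ j, (𝔼 b, knownProb A x α (m j) s j b / q.tupleProb x α (m j) j b) ^ u j := by
  have : Nonempty (Fin n) := ⟨α⟩
  have hc : ∀ j b, 0 < q.tupleProb x α (m j) j b := fun j b => tupleProb_pos (hm j) (hn j) b
  have hu1 : ∀ j, u j ≤ 1 := by
    intro j
    by_cases h : ∃ v ∈ q.atom j, v ∉ x
    · obtain ⟨v, hv, hx⟩ := h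
      exact (single_le_sum (fun i _ => hu i) (by simp [hv])).trans (hpack v hx)
    · rw [hdrop j h]; exact zero_le_one
  set g : Fin p → ι → (V → Fin n) → ℝ :=
    fun s j b => knownProb A x α (m j) s j b / q.tupleProb x α (m j) j b with hg
  have hg0 : ∀ s j b, 0 ≤ g s j b := fun s j b => div_nonneg (knownProb_nonneg _ _ _ _) (hc j b).le
  have hg1 : ∀ s j b, g s j b ≤ 1 := fun s j b =>
    div_le_one_of_le₀ (knownProb_le_tupleProb _ _ _ _) (hc j b).le
  have hpoint : ∀ b, 1 ≤ ∑ s, ∏ j, g s j b ^ u j := by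
    intro b
    have h1 : 1 ≤ ∑ s, ∏ j, g s j b := by
      simp only [hg, prod_div_distrib]
      rw [← sum_div, one_le_div (prod_pos fun j _ => hc j b)]
      exact prod_tupleProb_le_sum_prod_knownProb hA b
    refine h1.trans (sum_le_sum fun s _ => prod_le_prod (fun j _ => hg0 s j b) fun j _ => ?_)
    simpa using Real.rpow_le_rpow_of_exponent_ge' (hg0 s j b) (hg1 s j b) (hu j) (hu1 j)
  calc (1 : ℝ) ≤ 𝔼 b, ∑ s, ∏ j, g s j b ^ u j := le_expect univ_nonempty fun b _ => hpoint b
    _ = ∑ s, 𝔼 b, ∏ j, g s j b ^ u j := expect_sum_comm _ _ _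
    _ ≤ _ := by
      refine sum_le_sum fun s _ => ?_
      refine expect_prod_rpow_le_of_dependsOn (fun j => (q.atom j).toFinset \ x) hu (fun v => ?_)
        (g s) (hg0 s) fun j b b' h => ?_
      · by_cases hv : v ∈ x
        · simp [hv]
        · simpa [hv] using hpack v hv
      · simp only [hg]
        rw [dependsOn_knownProb (m j) s j h, tupleProb_eq b b']

/-- A server that receives at most `L` bits knows on average at most a fraction
`4 L / (m log₂ n)` of a random matching with `m` tuples. -/
theorem mul_logb_mul_expect_knownProb_div_le {m : ι → ℕ} (hm : ∀ j, 0 < m j)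
    (hn : ∀ j, m j ^ 2 ≤ n) {L : ℕ} (hL : ∀ I ∈ q.skewFamily m x α, A.load I ≤ L) (s : Fin p)
    {j : ι} (h : ∃ v ∈ q.atom j, v ∉ x) :
    m j * Real.logb 2 n * 𝔼 b, knownProb A x α (m j) s j b / q.tupleProb x α (m j) j b
      ≤ 4 * L := by
  have hn' : ∀ j, m j ≤ n := fun j => (Nat.le_self_pow two_ne_zero (m j)).trans (hn j)
  set F := q.skewRelations x α (m j) j with hF
  have hne : F.Nonempty := q.skewRelations_nonempty x α (hm j) (hn' j) j
  have hlen : ∀ S ∈ F, (A.msg j S s).length ≤ L := by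
    intro S hS
    -- The relation `S` is completed to an instance, whose load bounds the length of the message.
    obtain ⟨I, hI⟩ : (q.skewFamily m x α).Nonempty :=
      Fintype.piFinset_nonempty.2 fun j => q.skewRelations_nonempty x α (hm j) (hn' j) j
    rw [skewFamily, Fintype.mem_piFinset] at hI
    have hI' : update I j S ∈ q.skewFamily m x α := by
      rw [skewFamily, Fintype.mem_piFinset]
      intro i
      rcases eq_or_ne i j with rfl | hij
      · rwa [update_self]
      · rw [update_of_ne hij]; exact hI i
    refine le_trans ?_ (hL _ hI')
    refine le_trans ?_ (le_sup (f := fun s => ∑ i, (A.msg i (update I j S i) s).length)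
      (mem_univ s))
    refine le_trans (le_of_eq ?_) (single_le_sum
      (f := fun i => (A.msg i (update I j S i) s).length) (fun _ _ => Nat.zero_le _) (mem_univ j))
    simp only [update_self]
  have hknown := expect_card_knownPart_mul_logb_le hne α.pos
    (fun S hS K hK => pow_mul_card_filter_subset_sq_le h (hn j) hS hK) (fun S => A.msg j S s) hlen
  have hpos := tupleProb_pos (q := q) (x := x) (j := j) (α := α) (hm j) (hn' j) fun _ => α
  have hfrac := expect_pinnedTuple_mem_mul h hne (knownPart F fun S => A.msg j S s)
    (fun S hS => knownPart_subset hS rfl) fun _ => α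
  have havg : (𝔼 b, knownProb A x α (m j) s j b / q.tupleProb x α (m j) j b) * m j
      = 𝔼 S ∈ F, ((knownPart F (fun S => A.msg j S s) S).card : ℝ) := by
    simp_rw [fun b => tupleProb_eq (q := q) (x := x) (α := α) (m := m j) (j := j) b fun _ => α]
    rw [← expect_div, div_mul_eq_mul_div, div_eq_iff hpos.ne', mul_comm _ (tupleProb _ _ _ _ _ _)]
    exact hfrac
  calc _ = (𝔼 b, knownProb A x α (m j) s j b / q.tupleProb x α (m j) j b) * m j
        * Real.logb 2 n := by ring
    _ ≤ 4 * L := by rw [havg]; exact hknown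

end Correctness

section Main

theorem mul_packingLoad_le {κ : Type*} [Fintype κ] {u M : κ → ℝ} (hu : ∀ j, 0 ≤ u j) (hu0 : u ≠ 0)
    (hM : ∀ j, 0 ≤ M j) {p : ℕ} (hp : 0 < p) {c L : ℝ} (hc : 0 ≤ c) (hL : 0 ≤ L)
    (h : ∏ j, (c * M j) ^ u j ≤ p * L ^ ∑ j, u j) : c * packingLoad u M p ≤ L := by
  have hs : 0 < ∑ j, u j := by
    obtain ⟨j, hj⟩ := Function.ne_iff.1 hu0
    exact sum_pos' (fun j _ => hu j) ⟨j, mem_univ j, lt_of_le_of_ne (hu j) (Ne.symm hj)⟩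
  have hp0 : (0 : ℝ) < p := Nat.cast_pos.2 hp
  have hprod : 0 ≤ (∏ j, M j ^ u j) / p :=
    div_nonneg (prod_nonneg fun j _ => Real.rpow_nonneg (hM j) _) hp0.le
  have h1 : c ^ (∑ j, u j) * ((∏ j, M j ^ u j) / p) ≤ L ^ ∑ j, u j := by
    rw [← mul_div_assoc, div_le_iff₀ hp0, mul_comm _ (p : ℝ)]
    refine le_trans (le_of_eq ?_) h
    rw [Real.rpow_sum_of_nonneg hc fun j _ => hu j, ← prod_mul_distrib]
    exact prod_congr rfl fun j _ => (Real.mul_rpow hc (hM j)).symm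
  have h2 := Real.rpow_le_rpow (mul_nonneg (Real.rpow_nonneg hc _) hprod) h1
    (one_div_nonneg.2 hs.le)
  rwa [Real.mul_rpow (Real.rpow_nonneg hc _) hprod, ← Real.rpow_mul hc, ← Real.rpow_mul hL,
    mul_one_div_cancel hs.ne', Real.rpow_one, Real.rpow_one] at h2

variable {V ι : Type*} (q : ConjunctiveQuery V ι)

theorem arity_pos (j : ι) : 0 < q.arity j := List.length_pos_of_ne_nil (q.atom_ne_nil j)

theorem mem_residual_atom [DecidableEq V] {x : Finset V} {v : V} (hv : v ∉ x)
    (j : {j : ι // ∃ v ∈ q.atom j, v ∉ x}) :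
    ⟨v, hv⟩ ∈ (q.residual x).atom j ↔ v ∈ q.atom j.1 := by
  simp only [residual, List.mem_filterMap]
  constructor
  · rintro ⟨w, hw, hwv⟩
    split_ifs at hwv with hwx
    · simp only [Option.some.injEq, Subtype.mk.injEq] at hwv
      rwa [← hwv]
  · exact fun h => ⟨v, h, by simp [hv]⟩

variable [Fintype ι] [Nonempty ι]

theorem minInvArity_nonneg : 0 ≤ q.minInvArity := by
  rw [minInvArity, le_inf'_iff]
  exact fun j _ => by positivity

theorem minInvArity_mul_bitSize_le (m : ι → ℕ) {n : ℕ} (hn : 0 < n) (j : ι) :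
    q.minInvArity * q.bitSize m n j ≤ m j * Real.logb 2 n / 4 := by
  have ha : (0 : ℝ) < q.arity j := Nat.cast_pos.2 (q.arity_pos j)
  have hlog : 0 ≤ Real.logb 2 n := Real.logb_nonneg one_lt_two (by exact_mod_cast hn)
  have hle : q.minInvArity ≤ 1 / (4 * (q.arity j : ℝ)) := inf'_le _ (mem_univ j)
  refine (mul_le_mul_of_nonneg_right hle (by unfold bitSize; positivity)).trans (le_of_eq ?_)
  unfold bitSize
  field_simp

/-- The lower bound for one set `x` of skewed variables. -/
theorem forcesLoad_skewDistribution [Fintype V] [DecidableEq V] [DecidableEq ι] (m : ι → ℕ)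
    (hm : ∀ j, 0 < m j) (n : ℕ) (hn : ∀ j, m j ^ 2 ≤ n) (hn' : ∀ j, m j ≤ n) (α : Fin n) (p : ℕ)
    (hp : 0 < p) (x : Finset V) :
    q.ForcesLoad (q.skewDistribution m x α hm hn') p
      (q.minInvArity * q.residualLoad x (q.bitSize m n) p) := by
  intro A hA L hL
  replace hA : ∀ I ∈ q.skewFamily m x α, A.ComputesOn I := fun I hI =>
    hA I ((PMF.mem_support_uniformOfFinset_iff _ _).2 hI)
  replace hL : ∀ I ∈ q.skewFamily m x α, A.load I ≤ L := fun I hI =>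
    hL I ((PMF.mem_support_uniformOfFinset_iff _ _).2 hI)
  have hlog : 0 ≤ Real.logb 2 n := Real.logb_nonneg one_lt_two (by exact_mod_cast α.pos)
  have hM : ∀ j, 0 ≤ q.bitSize m n j := fun j => by unfold bitSize; positivity
  have hκ := q.minInvArity_nonneg
  rw [residualLoad, maxPackingLoad, ← smul_eq_mul, ← Real.sSup_smul_of_nonneg hκ]
  refine Real.sSup_le ?_ (Nat.cast_nonneg L)
  rintro _ ⟨_, ⟨u, ⟨⟨hu, hpack⟩, hu0⟩, rfl⟩, rfl⟩
  refine mul_packingLoad_le hu hu0 (fun j => hM j.1) hp hκ (Nat.cast_nonneg L) ?_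
  replace hpack : ∀ v, ∑ j with v ∈ (q.residual x).atom j, u j ≤ 1 := fun v => by
    convert hpack v
  classical
  -- The packing of the residual query, extended by `0` to the atoms that are dropped.
  set u' : ι → ℝ := fun j => if h : ∃ v ∈ q.atom j, v ∉ x then u ⟨j, h⟩ else 0 with hu'
  have hu'0 : ∀ j, 0 ≤ u' j := fun j => by
    simp only [hu']
    split_ifs
    · exact hu _
    · exact le_rfl
  have hdrop : ∀ j, (¬∃ v ∈ q.atom j, v ∉ x) → u' j = 0 := fun j h => dif_neg h
  have hext : ∀ j : {j : ι // ∃ v ∈ q.atom j, v ∉ x}, u' j.1 = u j := fun j => dif_pos j.2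
  have hpack' : ∀ v, v ∉ x → ∑ j with v ∈ q.atom j, u' j ≤ 1 := by
    intro v hv
    refine le_trans (le_of_eq ?_) (hpack ⟨v, hv⟩)
    symm
    refine sum_bij (fun j _ => j.1) (fun j hj => ?_) (fun _ _ _ _ => Subtype.ext) (fun j hj => ?_)
      fun j _ => (hext j).symm
    · exact mem_filter.2 ⟨mem_univ _, (q.mem_residual_atom hv j).1 (mem_filter.1 hj).2⟩
    · have hj' := (mem_filter.1 hj).2
      exact ⟨⟨j, v, hj', hv⟩,
        mem_filter.2 ⟨mem_univ _, (q.mem_residual_atom hv _).2 hj'⟩, rfl⟩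
  have hone := one_le_sum_prod_rpow hm hn' hA hu'0 hpack' hdrop
  set f : Fin p → ι → ℝ :=
    fun s j => 𝔼 b, knownProb A x α (m j) s j b / q.tupleProb x α (m j) j b with hf
  have hf0 : ∀ s j, 0 ≤ f s j := fun s j => expect_nonneg fun b _ =>
    div_nonneg (knownProb_nonneg _ _ _ _) (tupleProb_pos (hm j) (hn' j) b).le
  have hfL : ∀ s j, (q.minInvArity * q.bitSize m n j * f s j) ^ u' j ≤ (L : ℝ) ^ u' j := by
    intro s j
    by_cases h : ∃ v ∈ q.atom j, v ∉ x
    · refine Real.rpow_le_rpow (mul_nonneg (mul_nonneg hκ (hM j)) (hf0 s j)) ?_ (hu'0 j)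
      have h1 := mul_logb_mul_expect_knownProb_div_le hm hn hL s h
      have h2 := mul_le_mul_of_nonneg_right (q.minInvArity_mul_bitSize_le m α.pos j) (hf0 s j)
      linarith
    · simp [hdrop j h]
  have hprod0 : 0 ≤ ∏ j, (q.minInvArity * q.bitSize m n j) ^ u' j :=
    prod_nonneg fun j _ => Real.rpow_nonneg (mul_nonneg hκ (hM j)) _
  have hsub : ∀ g : ι → ℝ, (∀ j, (¬∃ v ∈ q.atom j, v ∉ x) → g j = 1) →
      ∏ j : {j : ι // ∃ v ∈ q.atom j, v ∉ x}, g j.1 = ∏ j, g j := by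
    intro g hg
    rw [← prod_subtype (univ.filter fun j => ∃ v ∈ q.atom j, v ∉ x) (by simp) g]
    exact prod_filter_of_ne fun j _ hj => not_imp_comm.1 (hg j) hj
  have hsum : ∑ j : {j : ι // ∃ v ∈ q.atom j, v ∉ x}, u j = ∑ j, u' j := by
    rw [← sum_congr rfl fun j _ => hext j,
      ← sum_subtype (univ.filter fun j => ∃ v ∈ q.atom j, v ∉ x) (by simp) u']
    exact sum_filter_of_ne fun j _ hj => not_imp_comm.1 (hdrop j) hj
  calc ∏ j : {j : ι // ∃ v ∈ q.atom j, v ∉ x}, (q.minInvArity * q.bitSize m n j.1) ^ u j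
      = ∏ j, (q.minInvArity * q.bitSize m n j) ^ u' j := by
        rw [← hsub _ fun j h => by rw [hdrop j h, Real.rpow_zero]]
        exact prod_congr rfl fun j _ => by rw [hext]
    _ ≤ (∏ j, (q.minInvArity * q.bitSize m n j) ^ u' j) * ∑ s, ∏ j, f s j ^ u' j :=
        le_mul_of_one_le_right hprod0 hone
    _ = ∑ s, ∏ j, (q.minInvArity * q.bitSize m n j * f s j) ^ u' j := by
        rw [mul_sum]
        refine sum_congr rfl fun s _ => ?_
        rw [← prod_mul_distrib]
        exact prod_congr rfl fun j _ => (Real.mul_rpow (mul_nonneg hκ (hM j)) (hf0 s j)).symm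
    _ ≤ ∑ _s : Fin p, ∏ j, (L : ℝ) ^ u' j := sum_le_sum fun s _ =>
        prod_le_prod (fun j _ => Real.rpow_nonneg (mul_nonneg (mul_nonneg hκ (hM j)) (hf0 s j)) _)
          fun j _ => hfL s j
    _ = p * (L : ℝ) ^ ∑ j, u j := by
        rw [← Real.rpow_sum_of_nonneg (Nat.cast_nonneg L) fun j _ => hu'0 j, hsum]
        simp

end Main

end ConjunctiveQuery

theorem mainTheorem2 {V ι : Type*} [Fintype V] [DecidableEq V] [Fintype ι] [DecidableEq ι]
    [Nonempty ι] (q : ConjunctiveQuery V ι) (m : ι → ℕ) (hm : ∀ j, 0 < m j)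
    (n : ℕ) (hn : ∀ j, m j ^ 2 ≤ n) (α : Fin n) (p : ℕ) (hp : 0 < p) :
    (∀ x : Finset V,
      q.ForcesLoad
        (q.skewDistribution m x α hm fun j => (Nat.le_self_pow two_ne_zero (m j)).trans (hn j))
        p (q.minInvArity * q.residualLoad x (q.bitSize m n) p)) ∧
    (∃ x : Finset V,
      q.ForcesLoad
        (q.skewDistribution m x α hm fun j => (Nat.le_self_pow two_ne_zero (m j)).trans (hn j))
        p (q.minInvArity * Finset.univ.sup' Finset.univ_nonempty
          fun y : Finset V => q.residualLoad y (q.bitSize m n) p)) := by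
  have h := fun x : Finset V => q.forcesLoad_skewDistribution m hm n hn
    (fun j => (Nat.le_self_pow two_ne_zero (m j)).trans (hn j)) α p hp x
  obtain ⟨x, -, hx⟩ := Finset.exists_mem_eq_sup' (Finset.univ_nonempty (α := Finset V))
    fun y : Finset V => q.residualLoad y (q.bitSize m n) p
  exact ⟨h, x, by rw [hx]; exact h x⟩
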